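/- Theorem. Every flotilla satisfies the Erdős–Hajnal conjecture. Here all tournaments are finite, $|T|$ is the number of vertices of a tournament $T$, and $T|X$ is the subtournament of $T$ induced by $X\subseteq V(T)$. A tournament is transitive if it has no directed cycle. A tournament $T$ contains a tournament $H$ if $H$ is isomorphic to $T|X$ for some $X\subseteq V(T)$; otherwise $T$ is $H$-free. A tournament $H$ satisfies the Erdős–Hajnal conjecture if there is $\epsilon>0$ such that every $H$-free tournament $T$ with $n$ vertices contains a transitive subtournament with at least $n^{\epsilon}$ vertices. Let $\theta=(v_1,\dots,v_n)$ be an ordering of $V(T)$. The graph of backward arcs $B(T,\theta)$ is the undirected graph with vertex set $V(T)$ in which, for $i<j$, the vertices $v_i$ and $v_j$ are adjacent if and only if $(v_j,v_i)$ is an arc of $T$. A boat is a tournament with four vertices $x,u,v,y$ and arcs $(y,x),(y,u),(v,x),(x,u),(u,v),(v,y)$; its path ordering is $(x,u,v,y)$, under which the backward arcs are $(y,u),(y,x),(v,x)$. A left boat (respectively right boat) of $B(T,\theta)$ is the subgraph induced by four vertices $v_{i_1},v_{i_2},v_{i_3},v_{i_4}$ with $i_1<i_2<i_3<i_4$ whose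 edges are exactly $v_{i_1}v_{i_3}$, $v_{i_1}v_{i_4}$, $v_{i_2}v_{i_4}$ (that is, it is the graph of backward arcs of a boat under its path ordering), where $i_3=i_2+1=i_1+2$ (respectively $i_4=i_3+1=i_2+2$). A tournament $T$ is a flotilla if there is an ordering $\theta$ of its vertices such that every connected component of $B(T,\theta)$ is a left boat or a right boat. -/

import Mathlib

universe u v

namespace FlotillaEHC

/-- A tournament on the vertex type `V`: a digraph without loops in which any two distinct
vertices are joined by exactly one of the two possible arcs. -/
structure Tournament (V : Type u) extends Digraph V where
  irrefl : ∀ a, ¬ Adj a a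
  adj_xor : ∀ a b, a ≠ b → Xor (Adj a b) (Adj b a)

namespace Tournament

variable {V : Type u} {W : Type v}

/-- The subtournament `T | X` induced by a set `X` of vertices. -/
def induce (T : Tournament V) (X : Set V) : Tournament X where
  Adj a b := T.Adj a b
  irrefl a := T.irrefl a
  adj_xor a b h := T.adj_xor a b (fun e => h (Subtype.ext e))

/-- A tournament is transitive if it has no directed cycle (no directed closed walk of positive
length). -/
def IsTransitive (T : Tournament V) : Prop :=
  ∀ a, ¬ Relation.TransGen T.Adj a a

/-- `T` contains `H` if `H` is isomorphic to `T | X` for some set `X` of vertices of `T`. -/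
def Contains (T : Tournament W) (H : Tournament V) : Prop :=
  ∃ X : Set W, Nonempty (H.Adj ≃r (T.induce X).Adj)

/-- `H` satisfies the Erdős–Hajnal conjecture: there is `ε > 0` such that every `H`-free
tournament with `n` vertices contains a transitive subtournament of size at least `n ^ ε`. -/
def SatisfiesEHC (H : Tournament V) : Prop :=
  ∃ ε : ℝ, 0 < ε ∧ ∀ (W : Type v) [Fintype W] (T : Tournament W), ¬ T.Contains H →
    ∃ X : Finset W, (T.induce (X : Set W)).IsTransitive ∧
      (Fintype.card W : ℝ) ^ ε ≤ (X.card : ℝ)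

/-- The graph of backward arcs `B(T, θ)`, for an ordering `θ = (θ 0, …, θ (n - 1))` of the
vertices. -/
def backwardGraph {n : ℕ} (T : Tournament V) (θ : Fin n ≃ V) : SimpleGraph V where
  Adj a b := (T.Adj a b ∧ θ.symm b < θ.symm a) ∨ (T.Adj b a ∧ θ.symm a < θ.symm b)
  symm := ⟨fun _ _ h => h.symm⟩
  loopless := ⟨fun a h => T.irrefl a (h.elim And.left And.left)⟩

/-- The boat `{x, u, v, y}`, with `x, u, v, y` being `0, 1, 2, 3`. Its path ordering
`(x, u, v, y)` is thus `Equiv.refl (Fin 4)`. -/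
def boat : Tournament (Fin 4) where
  Adj a b := (a, b) ∈
    ({(3, 0), (3, 1), (2, 0), (0, 1), (1, 2), (2, 3)} : Finset (Fin 4 × Fin 4))
  irrefl := by decide
  adj_xor := by unfold Xor; decide

/-- The vertices `θ (i 0), …, θ (i 3)`, listed in the order `θ`, induce in `B(T, θ)` the graph of
backward arcs of a boat under its path ordering. -/
def IsBoatAt {n : ℕ} (T : Tournament V) (θ : Fin n ≃ V) (i : Fin 4 → Fin n) : Prop :=
  StrictMono i ∧ ∀ a b, (T.backwardGraph θ).Adj (θ (i a)) (θ (i b)) ↔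
    (boat.backwardGraph (Equiv.refl (Fin 4))).Adj a b

/-- `X` is the vertex set of a left boat in `B(T, θ)`: the first three vertices are consecutive. -/
def IsLeftBoat {n : ℕ} (T : Tournament V) (θ : Fin n ≃ V) (X : Set V) : Prop :=
  ∃ i : Fin 4 → Fin n, X = Set.range (fun a => θ (i a)) ∧ T.IsBoatAt θ i ∧
    (i 1 : ℕ) = i 0 + 1 ∧ (i 2 : ℕ) = i 1 + 1

/-- `X` is the vertex set of a right boat in `B(T, θ)`: the last three vertices are consecutive. -/
def IsRightBoat {n : ℕ} (T : Tournament V) (θ : Fin n ≃ V) (X : Set V) : Prop :=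
  ∃ i : Fin 4 → Fin n, X = Set.range (fun a => θ (i a)) ∧ T.IsBoatAt θ i ∧
    (i 2 : ℕ) = i 1 + 1 ∧ (i 3 : ℕ) = i 2 + 1

/-- `θ` is a flotilla ordering of `T`: every connected component of `B(T, θ)` is a left boat or a
right boat. -/
def IsFlotillaOrdering {n : ℕ} (T : Tournament V) (θ : Fin n ≃ V) : Prop :=
  ∀ C : (T.backwardGraph θ).ConnectedComponent, T.IsLeftBoat θ C.supp ∨ T.IsRightBoat θ C.supp

/-- A flotilla is a tournament that has a flotilla ordering. -/
def IsFlotilla [Fintype V] (T : Tournament V) : Prop :=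
  ∃ θ : Fin (Fintype.card V) ≃ V, T.IsFlotillaOrdering θ

end Tournament

end FlotillaEHC

namespace FlotillaEHC.Tournament

open Finset
open scoped Classical

/-! ### Transitive sets and arc counts. -/

section

variable {W : Type v} (T : Tournament W)

/-! Take a minimal vertex set `X` with no transitive subset of size at least `t = |X| ^ ε`, where
`ε` satisfies `d ^ ε = 9/10` for a small constant `d`. By minimality every proper subset with at
least `m = d|X|` vertices has a transitive subset of size at least `9/10 * t`. Hence in `X` no set
of size `m` is complete to or from a transitive set of size `3/10 * t`, since the union would
contain a transitive set larger than `t` (`not_isComplete_trans`). In particular no two sets of size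
`m` are complete to each other. So backward arcs, though possibly rare, exist between any two large
sets.

If the tournament is `H`-free, greedy embedding gives linear-sized disjoint sets `S 0, …, S (n - 1)`
in `X` in which each vertex has few backward arcs to every other set (`exists_smooth_chain`). All
arcs between different components of the backward graph of a flotilla are forward, so components are
embedded one at a time, each time discarding the few vertices with a backward arc to a vertex
already placed (`contains_of_smooth`).

It remains to find a boat across four sets of the chain. Criticality supplies its backward arcs but
leaves two arcs uncontrolled; a wrong one is repaired with a vertex of the middle set
(`exists_left_boat`). The repair may permute the three consecutive vertices of the boat among their
sets. This is harmless because no vertex of another component lies between them, and it is where the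
left/right condition is used. -/

theorem adj_ne {T : Tournament W} {a b : W} (h : T.Adj a b) : a ≠ b := by
  rintro rfl
  exact T.irrefl _ h

theorem not_adj_iff {T : Tournament W} {a b : W} (h : a ≠ b) : ¬ T.Adj a b ↔ T.Adj b a := by
  have := T.adj_xor a b h
  unfold Xor at this
  tauto

theorem adj_asymm {T : Tournament W} {a b : W} (h : T.Adj a b) : ¬ T.Adj b a := fun h' =>
  (not_adj_iff (adj_ne h)).2 h' h

/-- The tournament with all arcs reversed. -/
def rev : Tournament W where
  Adj a b := T.Adj b a
  irrefl a := T.irrefl a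
  adj_xor a b h := T.adj_xor b a h.symm

/-- A finite set of vertices on which the arc relation is transitive. -/
def IsTransOn (X : Finset W) : Prop :=
  ∀ a ∈ X, ∀ b ∈ X, ∀ c ∈ X, T.Adj a b → T.Adj b c → T.Adj a c

/-- All arcs between `A` and `B` go from `A` to `B`. -/
def IsComplete (A B : Finset W) : Prop := ∀ a ∈ A, ∀ b ∈ B, T.Adj a b

/-- The number of arcs from `A` to `B`. -/
noncomputable def arcs (A B : Finset W) : ℕ := ∑ a ∈ A, #{b ∈ B | T.Adj a b}

variable {T}

theorem IsTransOn.mono {X Y : Finset W} (h : T.IsTransOn X) (hY : Y ⊆ X) : T.IsTransOn Y :=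
  fun a ha b hb c hc => h a (hY ha) b (hY hb) c (hY hc)

theorem IsTransOn.rev {X : Finset W} (h : T.IsTransOn X) : T.rev.IsTransOn X :=
  fun a ha b hb c hc hab hbc => h c hc b hb a ha hbc hab

theorem IsTransOn.isTransitive_induce {X : Finset W} (h : T.IsTransOn X) :
    (T.induce (X : Set W)).IsTransitive := by
  intro a ha
  have key : ∀ b, Relation.TransGen (T.induce (X : Set W)).Adj a b → T.Adj a b := by
    intro b hb
    induction hb with
    | single h1 => exact h1
    | tail _ h2 ih => exact h _ a.2 _ (Subtype.prop _) _ (Subtype.prop _) ih h2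
  exact T.irrefl _ (key a ha)

theorem IsComplete.disjoint {A B : Finset W} (h : T.IsComplete A B) : Disjoint A B :=
  Finset.disjoint_left.2 fun a ha hb => T.irrefl _ (h a ha a hb)

theorem IsComplete.isTransOn_union {A B : Finset W} (h : T.IsComplete A B)
    (hA : T.IsTransOn A) (hB : T.IsTransOn B) : T.IsTransOn (A ∪ B) := by
  intro a ha b hb c hc hab hbc
  rcases Finset.mem_union.1 ha with ha | ha <;> rcases Finset.mem_union.1 hb with hb | hb <;>
    rcases Finset.mem_union.1 hc with hc | hc
  · exact hA a ha b hb c hc hab hbc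
  · exact h a ha c hc
  · exact absurd hbc (adj_asymm (h c hc b hb))
  · exact h a ha c hc
  · exact absurd hab (adj_asymm (h b hb a ha))
  · exact absurd hab (adj_asymm (h b hb a ha))
  · exact absurd hbc (adj_asymm (h c hc b hb))
  · exact hB a ha b hb c hc hab hbc

/-- A vertex of maximum out-degree inside `X` works: an in-neighbour in `X` would, by transitivity,
have a strictly larger out-neighbourhood. -/
theorem IsTransOn.exists_source {X : Finset W} (h : T.IsTransOn X) (hX : X.Nonempty) :
    ∃ x ∈ X, ∀ b ∈ X, b ≠ x → T.Adj x b := by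
  obtain ⟨x, hx, hmax⟩ := X.exists_max_image (fun x => #{b ∈ X | T.Adj x b}) hX
  refine ⟨x, hx, fun b hb hbx => ?_⟩
  by_contra hn
  have hbx' : T.Adj b x := (not_adj_iff hbx.symm).1 hn
  refine absurd (hmax b hb) (not_le.2 (Finset.card_lt_card ?_))
  refine Finset.ssubset_iff_of_subset ?_ |>.2 ⟨x, by simp [hx, hbx'], by simp [T.irrefl]⟩
  intro c hc
  rw [Finset.mem_filter] at hc ⊢
  exact ⟨hc.1, h b hb x hx c hc.1 hbx' hc.2⟩

theorem IsTransOn.exists_initial {X : Finset W} (h : T.IsTransOn X) (k : ℕ) (hk : k ≤ #X) :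
    ∃ Y ⊆ X, #Y = k ∧ T.IsComplete Y (X \ Y) := by
  induction k with
  | zero => exact ⟨∅, by simp, by simp, by simp [IsComplete]⟩
  | succ k ih =>
    obtain ⟨Y, hY, hc, hcomp⟩ := ih (by omega)
    have hne : (X \ Y).Nonempty := by
      rw [← Finset.card_pos, Finset.card_sdiff_of_subset hY]
      omega
    obtain ⟨x, hx, hsrc⟩ := (h.mono Finset.sdiff_subset).exists_source hne
    have hx' := Finset.mem_sdiff.1 hx
    refine ⟨insert x Y, Finset.insert_subset hx'.1 hY, ?_, ?_⟩
    · rw [Finset.card_insert_of_notMem hx'.2, hc]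
    · intro a ha b hb
      simp only [Finset.mem_sdiff, Finset.mem_insert, not_or] at hb
      rcases Finset.mem_insert.1 ha with rfl | ha
      · exact hsrc b (Finset.mem_sdiff.2 ⟨hb.1, hb.2.2⟩) hb.2.1
      · exact hcomp a ha b (Finset.mem_sdiff.2 ⟨hb.1, hb.2.2⟩)

theorem arcs_mono {A A' B B' : Finset W} (hA : A' ⊆ A) (hB : B' ⊆ B) :
    T.arcs A' B' ≤ T.arcs A B :=
  (Finset.sum_le_sum fun _ _ => Finset.card_le_card (Finset.filter_subset_filter _ hB)).trans
    (Finset.sum_le_sum_of_subset hA)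

theorem arcs_eq_sum_right (A B : Finset W) : T.arcs A B = ∑ b ∈ B, #{a ∈ A | T.Adj a b} :=
  Finset.sum_card_bipartiteAbove_eq_sum_card_bipartiteBelow (s := A) (t := B) T.Adj

/-! ### Greedy embedding and sparse pairs. -/

/-- If no two large disjoint subsets of `U` have few arcs in one of the two directions, then every
pattern can be embedded with prescribed large disjoint parts. -/
theorem exists_embedding_of_arcs {l : ℝ} (hl : 0 < l) (m : ℕ) :
    ∃ K : ℝ, 1 ≤ K ∧ ∀ {W : Type v} [Nonempty W] (T : Tournament W) (U : Finset W) (s : ℝ), 0 < s →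
      (∀ A ⊆ U, ∀ B ⊆ U, Disjoint A B → s ≤ #A → s ≤ #B →
        l * #A * #B < T.arcs B A) →
      ∀ (X : ℕ → Finset W) (P : ℕ → ℕ → Prop), (∀ i < m, X i ⊆ U ∧ K * s ≤ #(X i)) →
        (∀ i j, i < j → j < m → Disjoint (X i) (X j)) →
        ∃ φ : ℕ → W, (∀ i < m, φ i ∈ X i) ∧
          ∀ i j, i < j → j < m → (T.Adj (φ i) (φ j) ↔ P i j) := by
  induction m with
  | zero =>
    exact ⟨1, le_rfl, fun {W} _ _ _ _ _ _ _ _ _ _ =>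
      ⟨fun _ => Classical.arbitrary W, by simp, by simp⟩⟩
  | succ m ih =>
    obtain ⟨K, hK1, hK⟩ := ih
    -- The term `m + 1` forces one of the `m` sets of bad candidates for the first vertex to have
    -- size at least `s` if they cover `X 0`; the term `K / l` leaves parts of size `K * s` after
    -- shrinking by the factor `l`.
    refine ⟨max (m + 1) (K / l), le_max_of_le_left (by simp),
      fun {W} hW T U s hs hU X P hX hd => ?_⟩
    let R : ℕ → W → Finset W := fun j v =>
      {w ∈ X (j + 1) | if P 0 (j + 1) then T.Adj v w else T.Adj w v}
    have hgood : ∃ v ∈ X 0, ∀ j < m, l * #(X (j + 1)) ≤ #(R j v) := by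
      by_contra! hcon
      let bad : ℕ → Finset W := fun j => {v ∈ X 0 | (#(R j v) : ℝ) < l * #(X (j + 1))}
      have hcover : X 0 ⊆ (Finset.range m).biUnion bad := by
        intro v hv
        obtain ⟨j, hj, hjv⟩ := hcon v hv
        exact Finset.mem_biUnion.2 ⟨j, Finset.mem_range.2 hj, Finset.mem_filter.2 ⟨hv, hjv⟩⟩
      have hlarge : ∃ j < m, s ≤ #(bad j) := by
        by_contra! hsmall
        have h1 : (#(X 0) : ℝ) ≤ ∑ j ∈ Finset.range m, (#(bad j) : ℝ) := by
          exact_mod_cast (Finset.card_le_card hcover).trans Finset.card_biUnion_le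
        have h2 : ∑ j ∈ Finset.range m, (#(bad j) : ℝ) ≤ ∑ _j ∈ Finset.range m, s :=
          Finset.sum_le_sum fun j hj => (hsmall j (Finset.mem_range.1 hj)).le
        have h3 := (hX 0 (by omega)).2
        have h4 : ((m : ℝ) + 1) * s ≤ max ((m : ℝ) + 1) (K / l) * s :=
          mul_le_mul_of_nonneg_right (le_max_left _ _) hs.le
        simp only [Finset.sum_const, Finset.card_range, nsmul_eq_mul] at h2
        linarith
      obtain ⟨j, hj, hbig⟩ := hlarge
      have hbadU : bad j ⊆ U := (Finset.filter_subset _ _).trans (hX 0 (by omega)).1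
      have hXj := hX (j + 1) (by omega)
      have hXs : s ≤ #(X (j + 1)) := by
        refine le_trans ?_ hXj.2
        have : 1 ≤ max ((m : ℝ) + 1) (K / l) := le_max_of_le_left (by simp)
        nlinarith
      have hdis : Disjoint (bad j) (X (j + 1)) :=
        Finset.disjoint_of_subset_left (Finset.filter_subset _ _) (hd 0 (j + 1) (by omega) (by omega))
      have hsum : ∑ v ∈ bad j, (#(R j v) : ℝ) ≤ ∑ _v ∈ bad j, l * #(X (j + 1)) :=
        Finset.sum_le_sum fun v hv => (Finset.mem_filter.1 hv).2.le
      simp only [Finset.sum_const, nsmul_eq_mul] at hsum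
      by_cases hP : P 0 (j + 1)
      · have := hU _ hXj.1 _ hbadU hdis.symm hXs hbig
        simp only [R, hP, if_true] at hsum
        rw [arcs] at this
        push_cast at this
        linarith
      · have := hU _ hbadU _ hXj.1 hdis hbig hXs
        simp only [R, hP, if_false] at hsum
        rw [arcs_eq_sum_right] at this
        push_cast at this
        linarith
    obtain ⟨v, hv, hvR⟩ := hgood
    obtain ⟨φ, hφ, hφP⟩ := hK T U s hs hU (fun j => R j v) (fun i j => P (i + 1) (j + 1))
      (fun j hj => ⟨(Finset.filter_subset _ _).trans (hX (j + 1) (by omega)).1, by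
        refine le_trans ?_ (hvR j hj)
        have h1 := (hX (j + 1) (by omega)).2
        have h2 : K / l * s ≤ max ((m : ℝ) + 1) (K / l) * s :=
          mul_le_mul_of_nonneg_right (le_max_right _ _) hs.le
        have h3 : l * (K / l * s) = K * s := by field_simp
        rw [← h3]
        exact mul_le_mul_of_nonneg_left (h2.trans h1) hl.le⟩)
      (fun i j hij hj => Finset.disjoint_of_subset_left (Finset.filter_subset _ _)
        (Finset.disjoint_of_subset_right (Finset.filter_subset _ _)
          (hd (i + 1) (j + 1) (by omega) (by omega))))
    refine ⟨fun i => Nat.casesOn i v φ, ?_, ?_⟩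
    · rintro (_ | i) hi
      · exact hv
      · exact (Finset.mem_filter.1 (hφ i (by omega))).1
    · rintro (_ | i) (_ | j) hij hj
      · omega
      · have h1 := Finset.mem_filter.1 (hφ j (by omega))
        change T.Adj v (φ j) ↔ P 0 (j + 1)
        by_cases hP : P 0 (j + 1)
        · simpa [hP] using h1.2
        · simp only [hP, if_false] at h1
          simpa [hP] using adj_asymm h1.2
      · omega
      · exact hφP i j (by omega) (by omega)

theorem exists_disjoint_parts (U : Finset W) (k s : ℕ) (h : k * s ≤ #U) :
    ∃ X : ℕ → Finset W, (∀ i < k, X i ⊆ U ∧ #(X i) = s) ∧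
      ∀ i j, i < j → j < k → Disjoint (X i) (X j) := by
  induction k with
  | zero => exact ⟨fun _ => ∅, by simp, by simp⟩
  | succ k ih =>
    rw [Nat.succ_mul] at h
    obtain ⟨X, hX, hd⟩ := ih (by omega)
    have hc : #((Finset.range k).biUnion X) ≤ k * s := by
      simpa using Finset.card_biUnion_le_card_mul (Finset.range k) X s
        fun i hi => (hX i (Finset.mem_range.1 hi)).2.le
    have hc2 := Finset.le_card_sdiff ((Finset.range k).biUnion X) U
    obtain ⟨Y, hY, hYc⟩ := Finset.exists_subset_card_eq
      (show s ≤ #(U \ (Finset.range k).biUnion X) by omega)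
    refine ⟨fun i => if i < k then X i else Y, ?_, ?_⟩
    · intro i hi
      by_cases hik : i < k
      · simpa [hik] using hX i hik
      · simpa [hik] using ⟨hY.trans Finset.sdiff_subset, hYc⟩
    · intro i j hij hj
      have hik : i < k := by omega
      by_cases hjk : j < k
      · simpa [hik, hjk] using hd i j hij hjk
      · simp only [hik, hjk, if_true, if_false]
        refine Finset.disjoint_of_subset_right hY (Finset.disjoint_of_subset_left ?_
          Finset.disjoint_sdiff)
        exact Finset.subset_biUnion_of_mem X (Finset.mem_range.2 hik)

theorem contains_of_adj_iff {V : Type u} {H : Tournament V} (f : V → W)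
    (hf : ∀ a b, T.Adj (f a) (f b) ↔ H.Adj a b) : T.Contains H := by
  have hinj : Function.Injective f := by
    intro a b hab
    by_contra hne
    by_cases h : H.Adj a b
    · exact T.irrefl _ (hab ▸ (hf a b).2 h)
    · exact T.irrefl _ (hab ▸ (hf b a).2 ((not_adj_iff hne).1 h))
  exact ⟨Set.range f, ⟨⟨Equiv.ofInjective f hinj, fun {a b} => hf a b⟩⟩⟩

/-- A tournament without `H` has two linear-sized sets with few backward arcs between them. -/
theorem exists_sparse_pair {n : ℕ} {V : Type u} (H : Tournament V) (θ : Fin n ≃ V) {l : ℝ}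
    (hl : 0 < l) :
    ∃ d : ℝ, 0 < d ∧ d ≤ 1 ∧ ∃ N : ℕ, ∀ {W : Type v} (T : Tournament W), ¬ T.Contains H →
      ∀ U : Finset W, N ≤ #U → ∃ A ⊆ U, ∃ B ⊆ U, Disjoint A B ∧
        d * #U ≤ #A ∧ d * #U ≤ #B ∧ (T.arcs B A : ℝ) ≤ l * #A * #B := by
  obtain ⟨K, hK1, hK⟩ := exists_embedding_of_arcs.{v} hl n
  have hpos : (0 : ℝ) < 2 * (n + 1) * K := by positivity
  refine ⟨1 / (2 * (n + 1) * K), by positivity, ?_, n + 1, fun {W} T hT U hU => ?_⟩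
  · rw [div_le_one hpos]
    have : (0 : ℝ) ≤ n := Nat.cast_nonneg n
    nlinarith
  by_contra! hcon
  have hUpos : 0 < #U := by omega
  have : Nonempty W := ⟨(Finset.card_pos.1 hUpos).choose⟩
  -- Dividing by `n + 1` covers `n = 0`; since `q ≥ 1`, rounding costs at most the factor 2 built
  -- into the constant.
  set q := #U / (n + 1) with hq
  have hq1 : 1 ≤ q := (Nat.one_le_div_iff (by omega)).2 hU
  have hqU : n * q ≤ #U :=
    (Nat.mul_le_mul_right q (Nat.le_succ n)).trans (Nat.mul_div_le _ _)
  obtain ⟨X, hX, hd⟩ := exists_disjoint_parts U n q hqU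
  have hq2 : (#U : ℝ) ≤ 2 * (n + 1) * q := by
    have h1 : #U < (n + 1) * q + (n + 1) := by
      have := Nat.div_add_mod #U (n + 1)
      have := Nat.mod_lt #U (show 0 < n + 1 by omega)
      rw [hq]
      omega
    have h2 : #U ≤ 2 * (n + 1) * q := by nlinarith
    exact_mod_cast h2
  obtain ⟨φ, hφX, hφ⟩ := hK T U (1 / (2 * (n + 1) * K) * #U)
    (by have : (0 : ℝ) < #U := by exact_mod_cast hUpos
        positivity)
    (fun A hA B hB hAB h1 h2 => hcon A hA B hB hAB h1 h2) X
    (fun i j => ∃ (hi : i < n) (hj : j < n), H.Adj (θ ⟨i, hi⟩) (θ ⟨j, hj⟩))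
    (fun i hi => ⟨(hX i hi).1, by
      rw [(hX i hi).2]
      have h3 : K * (1 / (2 * (n + 1) * K) * #U) = #U / (2 * (n + 1)) := by field_simp
      rw [h3, div_le_iff₀ (by positivity)]
      linarith⟩) hd
  refine hT (contains_of_adj_iff (fun a => φ (θ.symm a)) fun a b => ?_)
  have key : ∀ a b, θ.symm a < θ.symm b → (T.Adj (φ (θ.symm a)) (φ (θ.symm b)) ↔ H.Adj a b) := by
    intro a b hab
    rw [hφ _ _ hab (θ.symm b).2]
    simp
  rcases lt_trichotomy (θ.symm a) (θ.symm b) with h | h | h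
  · exact key a b h
  · have hab : a = b := θ.symm.injective h
    subst hab
    exact iff_of_false (T.irrefl _) (H.irrefl _)
  · have hne : a ≠ b := by
      rintro rfl
      exact lt_irrefl _ h
    have hne' : φ (θ.symm a) ≠ φ (θ.symm b) := by
      intro he
      refine Finset.disjoint_left.1 (hd _ _ h (θ.symm a).2) (hφX _ (θ.symm b).2) ?_
      exact he ▸ hφX _ (θ.symm a).2
    rw [← not_adj_iff hne.symm, ← not_adj_iff hne'.symm, key b a h]

/-- A tournament without `H` has arbitrarily long sequences of linear-sized disjoint sets with few
backward arcs between any two of them. -/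
theorem exists_sparse_chain {n : ℕ} {V : Type u} (H : Tournament V) (θ : Fin n ≃ V) (k : ℕ) :
    ∀ {l : ℝ}, 0 < l →
    ∃ c : ℝ, 0 < c ∧ c ≤ 1 ∧ ∃ N : ℕ, ∀ {W : Type v} (T : Tournament W), ¬ T.Contains H →
      ∀ U : Finset W, N ≤ #U → ∃ S : ℕ → Finset W, (∀ i < k, S i ⊆ U ∧ c * #U ≤ #(S i)) ∧
        ∀ i j, i < j → j < k → Disjoint (S i) (S j) ∧
          (T.arcs (S j) (S i) : ℝ) ≤ l * #(S i) * #(S j) := by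
  induction k with
  | zero =>
    intro l hl
    exact ⟨1, one_pos, le_rfl, 0, fun T _ U _ => ⟨fun _ => ∅, by simp, by simp⟩⟩
  | succ k ih =>
    intro l hl
    obtain ⟨c, hc, hc1, N, hN⟩ := ih hl
    -- The chain is continued inside `A`, with `B` as last set. Its members keep a fraction `c` of
    -- `A`, so density `l * c` between `A` and `B` becomes at most `l`.
    obtain ⟨d, hd, hd1, N', hN'⟩ := exists_sparse_pair.{u, v} H θ (mul_pos hl hc)
    refine ⟨c * d, mul_pos hc hd, mul_le_one₀ hc1 hd.le hd1, max N' ⌈N / d⌉₊,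
      fun {W} T hT U hU => ?_⟩
    obtain ⟨A, hA, B, hB, hAB, hAc, hBc, harc⟩ := hN' T hT U ((le_max_left _ _).trans hU)
    have hAN : N ≤ #A := by
      have h1 : (N : ℝ) / d ≤ #U :=
        (Nat.le_ceil _).trans (by exact_mod_cast (le_max_right _ _).trans hU)
      rw [div_le_iff₀ hd] at h1
      have : (N : ℝ) ≤ #A := by linarith
      exact_mod_cast this
    obtain ⟨S, hS, hSS⟩ := hN T hT A hAN
    refine ⟨fun i => if i < k then S i else B, ?_, ?_⟩
    · intro i hi
      by_cases hik : i < k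
      · simp only [hik, if_true]
        refine ⟨(hS i hik).1.trans hA, le_trans ?_ (hS i hik).2⟩
        rw [mul_assoc]
        exact mul_le_mul_of_nonneg_left hAc hc.le
      · simp only [hik, if_false]
        refine ⟨hB, le_trans ?_ hBc⟩
        have : 0 ≤ d * #U := by positivity
        nlinarith
    · intro i j hij hj
      have hik : i < k := by omega
      by_cases hjk : j < k
      · simpa only [hik, hjk, if_true] using hSS i j hij hjk
      · simp only [hik, hjk, if_true, if_false]
        refine ⟨Finset.disjoint_of_subset_left (hS i hik).1 hAB, ?_⟩
        have h1 : (T.arcs B (S i) : ℝ) ≤ T.arcs B A := by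
          exact_mod_cast arcs_mono le_rfl (hS i hik).1
        have h2 : l * (c * #A) * #B ≤ l * #(S i) * #B := by
          gcongr
          exact (hS i hik).2
        nlinarith

end

/-! ### Smooth chains. -/

section

variable {W : Type v} (T : Tournament W)

/-- The arc between a vertex `v` in position `i` and a vertex `w` in position `j` goes backward. -/
def IsBack (i j : ℕ) (v w : W) : Prop := (i < j ∧ T.Adj w v) ∨ (j < i ∧ T.Adj v w)

variable {T}

/-- A tournament without `H` has arbitrarily long sequences of linear-sized disjoint sets in which
every vertex is incident with few backward arcs to each other set. -/
theorem exists_smooth_chain {n : ℕ} {V : Type u} (H : Tournament V) (θ : Fin n ≃ V) (k : ℕ)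
    {l : ℝ} (hl : 0 < l) :
    ∃ c : ℝ, 0 < c ∧ ∃ N : ℕ, ∀ {W : Type v} (T : Tournament W), ¬ T.Contains H →
      ∀ U : Finset W, N ≤ #U → ∃ S : ℕ → Finset W, (∀ i < k, S i ⊆ U ∧ c * #U ≤ #(S i)) ∧
        ∀ i < k, ∀ j < k, i ≠ j → Disjoint (S i) (S j) ∧
          ∀ v ∈ S i, (#{w ∈ S j | T.IsBack i j v w} : ℝ) ≤ l * #(S j) := by
  -- By Markov's inequality at most a fraction `1 / (2 * (k + 1))` of `S i` exceeds the threshold `l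
  -- / 2` towards a given `S j`. Deleting all such vertices leaves at least half of each set, which
  -- turns `l / 2` into `l`.
  have hl' : 0 < l / (4 * (k + 1)) := by positivity
  obtain ⟨c, hc, -, N, hN⟩ := exists_sparse_chain.{u, v} H θ k hl'
  refine ⟨c / 2, by positivity, max N 1, fun {W} T hT U hU => ?_⟩
  obtain ⟨S, hS, hSS⟩ := hN T hT U ((le_max_left _ _).trans hU)
  have hUpos : (0 : ℝ) < #U := by exact_mod_cast (le_max_right N 1).trans hU
  have hSpos : ∀ i < k, (0 : ℝ) < #(S i) := fun i hi =>
    lt_of_lt_of_le (by positivity) (hS i hi).2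
  have hdis : ∀ i < k, ∀ j < k, i ≠ j → Disjoint (S i) (S j) := by
    intro i hi j hj hij
    rcases lt_or_gt_of_ne hij with h | h
    · exact (hSS i j h hj).1
    · exact (hSS j i h hi).1.symm
  have hsum : ∀ i < k, ∀ j < k, i ≠ j → (∑ v ∈ S i, (#{w ∈ S j | T.IsBack i j v w} : ℝ)) ≤
      l / (4 * (k + 1)) * #(S i) * #(S j) := by
    intro i hi j hj hij
    rcases lt_or_gt_of_ne hij with h | h
    · have h1 := (hSS i j h hj).2
      rw [arcs_eq_sum_right] at h1
      simpa [IsBack, h, h.not_gt] using h1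
    · have h1 := (hSS j i h hi).2
      rw [arcs] at h1
      rw [mul_right_comm]
      simpa [IsBack, h, h.not_gt] using h1
  let bad : ℕ → ℕ → Finset W := fun i j =>
    {v ∈ S i | l / 2 * #(S j) < #{w ∈ S j | T.IsBack i j v w}}
  have hbad : ∀ i < k, ∀ j < k, i ≠ j → (#(bad i j) : ℝ) ≤ #(S i) / (2 * (k + 1)) := by
    intro i hi j hj hij
    have h1 : ∑ _v ∈ bad i j, l / 2 * (#(S j) : ℝ) ≤ l / (4 * (k + 1)) * #(S i) * #(S j) := by
      refine le_trans ?_ (hsum i hi j hj hij)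
      refine (Finset.sum_le_sum fun v hv => (Finset.mem_filter.1 hv).2.le).trans ?_
      exact Finset.sum_le_sum_of_subset_of_nonneg (Finset.filter_subset _ _)
        fun _ _ _ => Nat.cast_nonneg _
    rw [Finset.sum_const, nsmul_eq_mul] at h1
    have h2 : (l / 2 * (#(S j) : ℝ)) * #(bad i j) ≤
        (l / 2 * (#(S j) : ℝ)) * (#(S i) / (2 * (k + 1))) := by
      refine le_trans (le_of_eq (mul_comm _ _)) (h1.trans (le_of_eq ?_))
      field_simp
      ring
    exact le_of_mul_le_mul_left h2 (mul_pos (by positivity) (hSpos j hj))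
  let rem : ℕ → Finset W := fun i => ((Finset.range k).erase i).biUnion (bad i)
  have hrem : ∀ i < k, (#(rem i) : ℝ) ≤ #(S i) / 2 := by
    intro i hi
    have h1 : (#(rem i) : ℝ) ≤ ∑ j ∈ (Finset.range k).erase i, (#(bad i j) : ℝ) := by
      exact_mod_cast Finset.card_biUnion_le
    have h2 : ∑ j ∈ (Finset.range k).erase i, (#(bad i j) : ℝ) ≤
        ∑ _j ∈ (Finset.range k).erase i, (#(S i) : ℝ) / (2 * (k + 1)) :=
      Finset.sum_le_sum fun j hj => hbad i hi j
        (Finset.mem_range.1 (Finset.mem_of_mem_erase hj)) (Finset.ne_of_mem_erase hj).symm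
    have h3 : ∑ _j ∈ (Finset.range k).erase i, (#(S i) : ℝ) / (2 * (k + 1)) ≤
        ∑ _j ∈ Finset.range k, (#(S i) : ℝ) / (2 * (k + 1)) :=
      Finset.sum_le_sum_of_subset_of_nonneg (Finset.erase_subset _ _)
        fun _ _ _ => by positivity
    rw [Finset.sum_const (s := Finset.range k), Finset.card_range, nsmul_eq_mul] at h3
    have h4 : (k : ℝ) * (#(S i) / (2 * (k + 1))) ≤ #(S i) / 2 := by
      rw [mul_div_assoc', div_le_div_iff₀ (by positivity) (by positivity)]
      nlinarith [hSpos i hi]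
    linarith
  have hcard : ∀ i < k, (#(S i) : ℝ) / 2 ≤ #(S i \ rem i) := by
    intro i hi
    have h1 : (#(S i) : ℝ) ≤ #(S i \ rem i) + #(rem i) := by
      exact_mod_cast (Nat.sub_le_iff_le_add.1 (Finset.le_card_sdiff (rem i) (S i)))
    linarith [hrem i hi]
  refine ⟨fun i => S i \ rem i, fun i hi => ⟨Finset.sdiff_subset.trans (hS i hi).1, ?_⟩,
    fun i hi j hj hij => ⟨Finset.disjoint_of_subset_left Finset.sdiff_subset
      (Finset.disjoint_of_subset_right Finset.sdiff_subset (hdis i hi j hj hij)), ?_⟩⟩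
  · linarith [hcard i hi, (hS i hi).2]
  · intro v hv
    obtain ⟨hvS, hvr⟩ := Finset.mem_sdiff.1 hv
    have h1 : (#{w ∈ S j \ rem j | T.IsBack i j v w} : ℝ) ≤ #{w ∈ S j | T.IsBack i j v w} := by
      exact_mod_cast Finset.card_le_card (Finset.filter_subset_filter _ Finset.sdiff_subset)
    have h2 : (#{w ∈ S j | T.IsBack i j v w} : ℝ) ≤ l / 2 * #(S j) := by
      by_contra! hcon
      exact hvr (Finset.mem_biUnion.2 ⟨j, by simp [hij.symm, hj],
        Finset.mem_filter.2 ⟨hvS, hcon⟩⟩)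
    have h3 := mul_le_mul_of_nonneg_left (hcard j hj) hl.le
    linarith

/-! ### Critical sets. -/

variable (T)

/-- All transitive subsets of `X` have fewer than `t` vertices, although every proper subset of `X`
with at least `m` vertices has a transitive subset almost that large. -/
structure IsCritical (X : Finset W) (t m : ℝ) : Prop where
  two_lt : 2 < t
  pos : 0 < m
  card_lt : ∀ Y ⊆ X, T.IsTransOn Y → (#Y : ℝ) < t
  exists_trans : ∀ Z ⊂ X, m ≤ #Z → ∃ Y ⊆ Z, T.IsTransOn Y ∧ 9 / 10 * t ≤ #Y

variable {T}

theorem IsCritical.rev {X : Finset W} {t m : ℝ} (h : T.IsCritical X t m) :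
    T.rev.IsCritical X t m where
  two_lt := h.two_lt
  pos := h.pos
  card_lt Y hY hT := h.card_lt Y hY hT.rev
  exists_trans Z hZ hm :=
    let ⟨Y, hY, hT, hc⟩ := h.exists_trans Z hZ hm
    ⟨Y, hY, hT.rev, hc⟩

/-- A transitive subset of `Z` of size `9/10 * t` together with `B` would be transitive of size at
least `12/10 * t`. -/
theorem IsCritical.not_isComplete_trans {X Z B : Finset W} {t m : ℝ} (h : T.IsCritical X t m)
    (hZ : Z ⊆ X) (hB : B ⊆ X) (hm : m ≤ #Z) (hBT : T.IsTransOn B) (hBc : 3 / 10 * t ≤ #B) :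
    ¬ T.IsComplete Z B := by
  intro hcomp
  have hBne : B.Nonempty := by
    rw [← Finset.card_pos]
    have : (0 : ℝ) < #B := by linarith [h.two_lt]
    exact_mod_cast this
  have hZX : Z ⊂ X := by
    refine hZ.ssubset_of_ne ?_
    rintro rfl
    obtain ⟨b, hb⟩ := hBne
    exact Finset.disjoint_left.1 hcomp.disjoint (hB hb) hb
  obtain ⟨Y, hY, hYT, hYc⟩ := h.exists_trans Z hZX hm
  have hcomp' : T.IsComplete Y B := fun a ha b hb => hcomp a (hY ha) b hb
  have h1 := h.card_lt (Y ∪ B) (Finset.union_subset (hY.trans hZ) hB)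
    (hcomp'.isTransOn_union hYT hBT)
  rw [Finset.card_union_of_disjoint hcomp'.disjoint] at h1
  push_cast at h1
  linarith [h.two_lt]

theorem IsCritical.not_isComplete {X Z B : Finset W} {t m : ℝ} (h : T.IsCritical X t m)
    (hZ : Z ⊆ X) (hB : B ⊆ X) (hm : m ≤ #Z) (hBm : m ≤ #B) : ¬ T.IsComplete Z B := by
  intro hcomp
  have hZne : Z.Nonempty := by
    rw [← Finset.card_pos]
    have : (0 : ℝ) < #Z := h.pos.trans_le hm
    exact_mod_cast this
  have hBX : B ⊂ X := by
    refine hB.ssubset_of_ne ?_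
    rintro rfl
    obtain ⟨z, hz⟩ := hZne
    exact Finset.disjoint_left.1 hcomp.disjoint hz (hZ hz)
  obtain ⟨Y, hY, hYT, hYc⟩ := h.exists_trans B hBX hBm
  exact h.not_isComplete_trans hZ (hY.trans hB) hm hYT (by linarith [h.two_lt])
    fun a ha b hb => hcomp a ha b (hY hb)

/-! ### Boats in critical sets. -/

theorem adj_iff_boat {b : Fin 4 → W} (h30 : T.Adj (b 3) (b 0)) (h31 : T.Adj (b 3) (b 1))
    (h20 : T.Adj (b 2) (b 0)) (h01 : T.Adj (b 0) (b 1)) (h12 : T.Adj (b 1) (b 2))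
    (h23 : T.Adj (b 2) (b 3)) (i j : Fin 4) : T.Adj (b i) (b j) ↔ boat.Adj i j := by
  have := T.irrefl
  fin_cases i <;> fin_cases j <;> simp [boat, *, adj_asymm]

/-- A tail vertex dominating parts of two sets on one side yields a boat, with its other three
vertices in `A ∪ M ∪ B`. -/
theorem IsCritical.exists_left_boat {X A M B D : Finset W} {t m : ℝ} (h : T.IsCritical X t m)
    (hA : A ⊆ X) (hB : B ⊆ X) (hD : D ⊆ X) (hAm : 2 * m ≤ #A) (hBm : m ≤ #B) (hDm : 2 * m ≤ #D)
    (hAB : Disjoint A B) (hAD : Disjoint A D) (hBD : Disjoint B D)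
    (hM : ∀ x ∈ A, ∀ z ∈ B, ∀ y ∈ D, ∃ w ∈ M, T.Adj x w ∧ T.Adj w z ∧ T.Adj w y) :
    ∃ b : Fin 4 → W, (∀ i j, T.Adj (b i) (b j) ↔ boat.Adj i j) ∧ b 3 ∈ D ∧
      ∀ i ≠ 3, b i ∈ A ∨ b i ∈ M ∨ b i ∈ B := by
  have hBX : B ⊂ X := by
    refine hB.ssubset_of_ne ?_
    rintro rfl
    have : (0 : ℝ) < #D := by linarith [h.pos]
    obtain ⟨y, hy⟩ := Finset.card_pos.1 (by exact_mod_cast this : 0 < #D)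
    exact Finset.disjoint_left.1 hBD (hD hy) hy
  obtain ⟨Y, hY, hYT, hYc⟩ := h.exists_trans B hBX hBm
  -- Splitting `Y` into halves yields the arc `u → v` for any `u` in the first and `v` in the
  -- second. As `#Y ≥ 2`, each half has at least a third of `Y`, hence `3/10 * t` vertices.
  obtain ⟨B₁, hB₁, hB₁c, hcomp⟩ := hYT.exists_initial (#Y / 2) (Nat.div_le_self _ _)
  have hY2 : 2 ≤ #Y := by
    have : (1 : ℝ) < #Y := by linarith [h.two_lt]
    exact_mod_cast this
  have hhalf : 3 / 10 * t ≤ (#Y / 2 : ℕ) := by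
    have h1 : #Y ≤ 3 * (#Y / 2) := by omega
    have h2 : (#Y : ℝ) ≤ 3 * (#Y / 2 : ℕ) := by exact_mod_cast h1
    linarith
  have hB₁t : 3 / 10 * t ≤ #B₁ := by rw [hB₁c]; exact hhalf
  have hB₂t : 3 / 10 * t ≤ #(Y \ B₁) := by
    rw [Finset.card_sdiff_of_subset hB₁, hB₁c]
    refine hhalf.trans ?_
    exact_mod_cast (by omega : #Y / 2 ≤ #Y - #Y / 2)
  have hB₁B : B₁ ⊆ B := hB₁.trans hY
  have hB₂B : Y \ B₁ ⊆ B := Finset.sdiff_subset.trans hY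
  set D' : Finset W := {y ∈ D | ∃ u ∈ B₁, T.Adj y u} with hD'
  have hD'c : m ≤ #D' := by
    have h1 : (#(D \ D') : ℝ) < m := by
      by_contra! hcon
      refine h.rev.not_isComplete_trans (Finset.sdiff_subset.trans hD) (hB₁B.trans hB) hcon
        (hYT.mono hB₁).rev hB₁t fun y hy u hu => ?_
      obtain ⟨hyD, hyD'⟩ := Finset.mem_sdiff.1 hy
      change T.Adj u y
      refine (not_adj_iff ?_).1 fun hyu => hyD' (Finset.mem_filter.2 ⟨hyD, u, hu, hyu⟩)
      rintro rfl
      exact Finset.disjoint_left.1 hBD (hB₁B hu) hyD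
    have h2 : (#D : ℝ) ≤ #(D \ D') + #D' := by
      exact_mod_cast Nat.sub_le_iff_le_add.1 (Finset.le_card_sdiff D' D)
    linarith
  have hD'D : D' ⊆ D := Finset.filter_subset _ _
  set A₁ : Finset W := {x ∈ A | ∀ y ∈ D', ¬ T.Adj y x} with hA₁
  set A₂ : Finset W := {x ∈ A | ∀ v ∈ Y \ B₁, ¬ T.Adj v x} with hA₂
  have hA₁m : (#A₁ : ℝ) < m := by
    by_contra! hcon
    refine h.not_isComplete ((Finset.filter_subset _ _).trans hA) (hD'D.trans hD) hcon hD'c ?_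
    intro x hx y hy
    obtain ⟨hxA, hx⟩ := Finset.mem_filter.1 hx
    refine (not_adj_iff ?_).1 (hx y hy)
    rintro rfl
    exact Finset.disjoint_left.1 hAD hxA (hD'D hy)
  have hA₂m : (#A₂ : ℝ) < m := by
    by_contra! hcon
    refine h.not_isComplete_trans ((Finset.filter_subset _ _).trans hA) (hB₂B.trans hB) hcon
      (hYT.mono Finset.sdiff_subset) hB₂t ?_
    intro x hx v hv
    obtain ⟨hxA, hx⟩ := Finset.mem_filter.1 hx
    refine (not_adj_iff ?_).1 (hx v hv)
    rintro rfl
    exact Finset.disjoint_left.1 hAB hxA (hB₂B hv)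
  -- Each exceptional set has fewer than `m` elements, so some `x` has in-neighbours both in `D'`
  -- and in the second half of `Y`. This gives all the boat's arcs except `x → u` and `v → y`.
  obtain ⟨x, hxA, hx⟩ : ∃ x ∈ A, x ∉ A₁ ∪ A₂ := by
    by_contra! hcon
    have h1 : (#A : ℝ) ≤ #A₁ + #A₂ := by
      exact_mod_cast (Finset.card_le_card hcon).trans (Finset.card_union_le _ _)
    linarith
  simp only [hA₁, hA₂, Finset.mem_union, Finset.mem_filter, hxA, true_and, not_or, not_forall,
    not_not] at hx
  obtain ⟨⟨y, hyD', hyx⟩, v, hv, hvx⟩ := hx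
  obtain ⟨hyD, u, hu, hyu⟩ := Finset.mem_filter.1 hyD'
  have huv := hcomp u hu v hv
  have hxu : x ≠ u := by
    rintro rfl
    exact Finset.disjoint_left.1 hAB hxA (hB₁B hu)
  have hvy : v ≠ y := by
    rintro rfl
    exact Finset.disjoint_left.1 hBD (hB₂B hv) hyD
  -- If `u → x`, then `u, x, w, y` is a boat; if `y → v`, then `v, x, w, y` is one. If neither arc
  -- is wrong, `x, u, v, y` already is.
  by_cases hux : T.Adj u x
  · obtain ⟨w, hwM, hxw, hwu, hwy⟩ := hM x hxA u (hB₁B hu) y hyD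
    refine ⟨![u, x, w, y], adj_iff_boat hyu hyx hwu hux hxw hwy, hyD, fun i hi => ?_⟩
    fin_cases i
    · exact Or.inr (Or.inr (hB₁B hu))
    · exact Or.inl hxA
    · exact Or.inr (Or.inl hwM)
    · exact absurd rfl hi
  by_cases hyv : T.Adj y v
  · obtain ⟨w, hwM, hxw, hwv, hwy⟩ := hM x hxA v (hB₂B hv) y hyD
    refine ⟨![v, x, w, y], adj_iff_boat hyv hyx hwv hvx hxw hwy, hyD, fun i hi => ?_⟩
    fin_cases i
    · exact Or.inr (Or.inr (hB₂B hv))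
    · exact Or.inl hxA
    · exact Or.inr (Or.inl hwM)
    · exact absurd rfl hi
  · refine ⟨![x, u, v, y], adj_iff_boat hyx hyu hvx ((not_adj_iff hxu.symm).1 hux) huv
      ((not_adj_iff hvy.symm).1 hyv), hyD, fun i hi => ?_⟩
    fin_cases i
    · exact Or.inl hxA
    · exact Or.inr (Or.inr (hB₁B hu))
    · exact Or.inr (Or.inr (hB₂B hv))
    · exact absurd rfl hi

/-- Reversing all arcs preserves criticality, and a boat becomes a boat with its path ordering
reversed. -/
theorem IsCritical.exists_right_boat {X A M B D : Finset W} {t m : ℝ} (h : T.IsCritical X t m)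
    (hA : A ⊆ X) (hB : B ⊆ X) (hD : D ⊆ X) (hAm : 2 * m ≤ #A) (hBm : m ≤ #B) (hDm : 2 * m ≤ #D)
    (hAB : Disjoint A B) (hAD : Disjoint A D) (hBD : Disjoint B D)
    (hM : ∀ x ∈ A, ∀ z ∈ B, ∀ y ∈ D, ∃ w ∈ M, T.Adj w x ∧ T.Adj z w ∧ T.Adj y w) :
    ∃ b : Fin 4 → W, (∀ i j, T.Adj (b i) (b j) ↔ boat.Adj i j) ∧ b 0 ∈ D ∧
      ∀ i ≠ 0, b i ∈ A ∨ b i ∈ M ∨ b i ∈ B := by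
  obtain ⟨b, hb, hbD, hbM⟩ := h.rev.exists_left_boat hA hB hD hAm hBm hDm hAB hAD hBD hM
  refine ⟨fun i => b i.rev, ?_, hbD, fun i hi => hbM _ ?_⟩
  · intro i j
    refine (hb j.rev i.rev).trans ?_
    fin_cases i <;> fin_cases j <;> simp [boat, Fin.rev]
  · revert hi
    fin_cases i <;> simp [Fin.rev]

end

/-! ### Placing components in a smooth chain. -/

variable {V : Type u} {W : Type v} {T : Tournament W} {H : Tournament V} {n : ℕ} {θ : Fin n ≃ V}

theorem adj_of_not_isBack {i j : ℕ} {v w : W} (hij : i < j) (hne : v ≠ w)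
    (h : ¬ T.IsBack i j v w) : T.Adj v w :=
  (not_adj_iff hne.symm).1 fun hwv => h (Or.inl ⟨hij, hwv⟩)

theorem adj_of_not_isBack' {i j : ℕ} {v w : W} (hij : j < i) (hne : v ≠ w)
    (h : ¬ T.IsBack i j v w) : T.Adj w v :=
  (not_adj_iff hne).1 fun hvw => h (Or.inr ⟨hij, hvw⟩)

/-- The connected component of the vertex in position `p`. -/
def component (H : Tournament V) (θ : Fin n ≃ V) (p : Fin n) :
    (H.backwardGraph θ).ConnectedComponent :=
  (H.backwardGraph θ).connectedComponentMk (θ p)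

theorem adj_iff_lt_of_component_ne {p q : Fin n} (h : H.component θ p ≠ H.component θ q) :
    H.Adj (θ p) (θ q) ↔ p < q := by
  have hnot : ¬ (H.backwardGraph θ).Adj (θ p) (θ q) := fun hadj =>
    h (SimpleGraph.ConnectedComponent.sound hadj.reachable)
  have hpq : p ≠ q := fun e => h (e ▸ rfl)
  have hne : θ p ≠ θ q := fun e => hpq (θ.injective e)
  simp only [backwardGraph, Equiv.symm_apply_apply, not_or, not_and] at hnot
  rcases lt_or_gt_of_ne hpq with hlt | hlt
  · exact iff_of_true ((not_adj_iff hne.symm).1 fun hqp => hnot.2 hqp hlt) hlt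
  · exact iff_of_false (fun hpq => hnot.1 hpq hlt) hlt.not_gt

theorem IsBoatAt.adj_iff {i : Fin 4 → Fin n} (h : H.IsBoatAt θ i) (a b : Fin 4) :
    H.Adj (θ (i a)) (θ (i b)) ↔ boat.Adj a b := by
  have key : ∀ a b : Fin 4, a < b → (H.Adj (θ (i b)) (θ (i a)) ↔ boat.Adj b a) := by
    intro a b hab
    have h1 := h.2 b a
    simpa [backwardGraph, h.1 hab, (h.1 hab).not_gt, hab, hab.not_gt] using h1
  rcases lt_trichotomy a b with hab | rfl | hab
  · have h1 : θ (i b) ≠ θ (i a) := fun e => (h.1 hab).ne' (θ.injective e)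
    rw [← not_adj_iff h1, ← not_adj_iff hab.ne', key a b hab]
  · exact iff_of_false (H.irrefl _) (boat.irrefl _)
  · exact key b a hab

/-- A copy of a component is placed in the sets `S`: the vertex in position `p` is chosen in a
set whose position is not separated from `p` by other components. -/
def IsPlaced (H : Tournament V) (θ : Fin n ≃ V) (S : ℕ → Finset W) (φ : Fin n → W)
    (β : Fin n → Fin n) (p : Fin n) : Prop :=
  φ p ∈ S (β p) ∧ H.component θ (β p) = H.component θ p ∧
    ∀ r, H.component θ r ≠ H.component θ p → (r < β p ↔ r < p)

theorem exists_placed_of_boat {S : ℕ → Finset W} {C : (H.backwardGraph θ).ConnectedComponent}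
    {i : Fin 4 → Fin n} (hC : C.supp = Set.range (fun a => θ (i a))) (hi : H.IsBoatAt θ i)
    {b : Fin 4 → W} (hb : ∀ j k, T.Adj (b j) (b k) ↔ boat.Adj j k)
    (hS : ∀ a, ∃ g, b a ∈ S (i g) ∧ ∀ r, (∀ j, r ≠ i j) → (r < i g ↔ r < i a)) :
    ∃ (φ : Fin n → W) (β : Fin n → Fin n), (∀ p, H.component θ p = C → H.IsPlaced θ S φ β p) ∧
      ∀ p q, H.component θ p = C → H.component θ q = C →
        (T.Adj (φ p) (φ q) ↔ H.Adj (θ p) (θ q)) := by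
  choose g hg hgr using hS
  have hmem : ∀ p, H.component θ p = C ↔ ∃ a, i a = p := by
    intro p
    rw [component, ← SimpleGraph.ConnectedComponent.mem_supp_iff, hC]
    simp
  have hinj := hi.1.injective
  -- The values `b 0` and `id` outside the component are never used.
  refine ⟨Function.extend i b fun _ => b 0, Function.extend i (i ∘ g) id, ?_, ?_⟩
  · intro p hp
    obtain ⟨a, rfl⟩ := (hmem p).1 hp
    rw [IsPlaced, hinj.extend_apply, hinj.extend_apply, hp]
    refine ⟨hg a, (hmem _).2 ⟨g a, rfl⟩, fun r hr => hgr a r ?_⟩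
    rintro j rfl
    exact hr ((hmem _).2 ⟨j, rfl⟩)
  · intro p q hp hq
    obtain ⟨a, rfl⟩ := (hmem p).1 hp
    obtain ⟨a', rfl⟩ := (hmem q).1 hq
    rw [hinj.extend_apply, hinj.extend_apply, hb, hi.adj_iff]

theorem IsCritical.exists_placed_component {X : Finset W} {t m : ℝ} (h : T.IsCritical X t m)
    {S : ℕ → Finset W} (hS : ∀ p < n, S p ⊆ X ∧ 2 * m ≤ #(S p))
    (hdis : ∀ p < n, ∀ q < n, p ≠ q → Disjoint (S p) (S q))
    (hgen : ∀ r < n, ∀ p < n, ∀ q < n, ∀ s < n, p ≠ r → q ≠ r → s ≠ r →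
      ∀ x ∈ S p, ∀ z ∈ S q, ∀ y ∈ S s, ∃ w ∈ S r,
        ¬ T.IsBack p r x w ∧ ¬ T.IsBack q r z w ∧ ¬ T.IsBack s r y w)
    {C : (H.backwardGraph θ).ConnectedComponent}
    (hC : H.IsLeftBoat θ C.supp ∨ H.IsRightBoat θ C.supp) :
    ∃ (φ : Fin n → W) (β : Fin n → Fin n), (∀ p, H.component θ p = C → H.IsPlaced θ S φ β p) ∧
      ∀ p q, H.component θ p = C → H.component θ q = C →
        (T.Adj (φ p) (φ q) ↔ H.Adj (θ p) (θ q)) := by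
  have hm := h.pos
  have hne : ∀ {p q : Fin n} {x y : W}, p < q → x ∈ S p → y ∈ S q → x ≠ y := by
    rintro p q x _ hpq hx hy rfl
    exact Finset.disjoint_left.1 (hdis p p.2 q q.2 (Fin.val_ne_of_ne hpq.ne)) hx hy
  have hdis' : ∀ {p q : Fin n}, p ≠ q → Disjoint (S p) (S q) := fun {p q} hpq =>
    hdis p p.2 q q.2 (Fin.val_ne_of_ne hpq)
  rcases hC with ⟨i, hCi, hi, h01, h12⟩ | ⟨i, hCi, hi, h12, h23⟩
  · have l01 : i 0 < i 1 := hi.1 (by decide)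
    have l12 : i 1 < i 2 := hi.1 (by decide)
    have l23 : i 2 < i 3 := hi.1 (by decide)
    have hbig : ∀ a, m ≤ #(S (i a)) := fun a => by linarith [(hS (i a) (i a).2).2]
    obtain ⟨b, hb, hb3, hbM⟩ := h.exists_left_boat (A := S (i 0)) (M := S (i 1)) (B := S (i 2))
      (D := S (i 3)) (hS _ (i 0).2).1 (hS _ (i 2).2).1 (hS _ (i 3).2).1 (hS _ (i 0).2).2
      (hbig 2) (hS _ (i 3).2).2 (hdis' (l01.trans l12).ne)
      (hdis' (l01.trans (l12.trans l23)).ne) (hdis' l23.ne) (by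
        intro x hx z hz y hy
        obtain ⟨w, hw, h1, h2, h3⟩ := hgen (i 1) (i 1).2 (i 0) (i 0).2 (i 2) (i 2).2 (i 3) (i 3).2
          (Fin.val_ne_of_ne l01.ne) (Fin.val_ne_of_ne l12.ne')
          (Fin.val_ne_of_ne (l12.trans l23).ne') x hx z hz y hy
        exact ⟨w, hw, adj_of_not_isBack l01 (hne l01 hx hw) h1,
          adj_of_not_isBack' l12 (hne l12 hw hz).symm h2,
          adj_of_not_isBack' (l12.trans l23) (hne (l12.trans l23) hw hy).symm h3⟩)
    refine exists_placed_of_boat hCi hi hb fun a => ?_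
    by_cases ha : a = 3
    · subst ha
      exact ⟨3, hb3, fun _ _ => Iff.rfl⟩
    -- The first three positions are consecutive, so every position outside the component is on the
    -- same side of all three.
    · have hcons : ∀ j k : Fin 4, j ≠ 3 → k ≠ 3 → ∀ r, (∀ a, r ≠ i a) → (r < i j ↔ r < i k) := by
        intro j k hj hk r hr
        have h0 := Fin.val_ne_of_ne (hr 0)
        have h1 := Fin.val_ne_of_ne (hr 1)
        have h2 := Fin.val_ne_of_ne (hr 2)
        simp only [Fin.lt_def]
        fin_cases j <;> fin_cases k <;> simp at hj hk ⊢ <;> omega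
      rcases hbM a ha with hA | hA | hA
      · exact ⟨0, hA, hcons 0 a (by decide) ha⟩
      · exact ⟨1, hA, hcons 1 a (by decide) ha⟩
      · exact ⟨2, hA, hcons 2 a (by decide) ha⟩
  · have l01 : i 0 < i 1 := hi.1 (by decide)
    have l12 : i 1 < i 2 := hi.1 (by decide)
    have l23 : i 2 < i 3 := hi.1 (by decide)
    have hbig : ∀ a, m ≤ #(S (i a)) := fun a => by linarith [(hS (i a) (i a).2).2]
    obtain ⟨b, hb, hb0, hbM⟩ := h.exists_right_boat (A := S (i 3)) (M := S (i 2)) (B := S (i 1))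
      (D := S (i 0)) (hS _ (i 3).2).1 (hS _ (i 1).2).1 (hS _ (i 0).2).1 (hS _ (i 3).2).2
      (hbig 1) (hS _ (i 0).2).2 (hdis' (l12.trans l23).ne')
      (hdis' (l01.trans (l12.trans l23)).ne') (hdis' l01.ne') (by
        intro x hx z hz y hy
        obtain ⟨w, hw, h1, h2, h3⟩ := hgen (i 2) (i 2).2 (i 3) (i 3).2 (i 1) (i 1).2 (i 0) (i 0).2
          (Fin.val_ne_of_ne l23.ne') (Fin.val_ne_of_ne l12.ne)
          (Fin.val_ne_of_ne (l01.trans l12).ne) x hx z hz y hy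
        exact ⟨w, hw, adj_of_not_isBack' l23 (hne l23 hw hx).symm h1,
          adj_of_not_isBack l12 (hne l12 hz hw) h2,
          adj_of_not_isBack (l01.trans l12) (hne (l01.trans l12) hy hw) h3⟩)
    refine exists_placed_of_boat hCi hi hb fun a => ?_
    by_cases ha : a = 0
    · subst ha
      exact ⟨0, hb0, fun _ _ => Iff.rfl⟩
    · have hcons : ∀ j k : Fin 4, j ≠ 0 → k ≠ 0 → ∀ r, (∀ a, r ≠ i a) → (r < i j ↔ r < i k) := by
        intro j k hj hk r hr
        have h0 := Fin.val_ne_of_ne (hr 1)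
        have h1 := Fin.val_ne_of_ne (hr 2)
        have h2 := Fin.val_ne_of_ne (hr 3)
        simp only [Fin.lt_def]
        fin_cases j <;> fin_cases k <;> simp at hj hk ⊢ <;> omega
      rcases hbM a ha with hA | hA | hA
      · exact ⟨3, hA, hcons 3 a (by decide) ha⟩
      · exact ⟨2, hA, hcons 2 a (by decide) ha⟩
      · exact ⟨1, hA, hcons 1 a (by decide) ha⟩

/-- Replacing `p` by `β p` and `q` by `β' q` does not change their order, since neither move crosses
a position of another component. A non-backward arc therefore follows the order of `p` and `q`. -/
theorem adj_iff_lt_of_placed {S S' : ℕ → Finset W}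
    (hdis : ∀ p < n, ∀ q < n, p ≠ q → Disjoint (S p) (S q)) (hS' : ∀ p, S' p ⊆ S p)
    {φ φ' : Fin n → W} {β β' : Fin n → Fin n} {p q : Fin n} (hp : H.IsPlaced θ S φ β p)
    (hq : H.IsPlaced θ S' φ' β' q) (hpq : H.component θ p ≠ H.component θ q)
    (hback : ¬ T.IsBack (β p) (β' q) (φ p) (φ' q)) :
    (T.Adj (φ p) (φ' q) ↔ p < q) ∧ (T.Adj (φ' q) (φ p) ↔ q < p) := by
  obtain ⟨hpS, hpc, hpr⟩ := hp
  obtain ⟨hqS, hqc, hqr⟩ := hq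
  have h1 := hqr (β p) (by rw [hpc]; exact hpq)
  have h2 := hpr q hpq.symm
  have hne1 : p ≠ q := fun e => hpq (e ▸ rfl)
  have hne2 : β p ≠ q := fun e => hpq (by rw [← hpc, e])
  have hne3 : β p ≠ β' q := fun e => hpq (by rw [← hpc, e, hqc])
  have hne : φ p ≠ φ' q := fun e => Finset.disjoint_left.1
    (hdis _ (β p).2 _ (β' q).2 (Fin.val_ne_of_ne hne3)) hpS (e ▸ hS' _ hqS)
  rcases lt_or_gt_of_ne hne1 with hlt | hlt
  · have h3 : β p < q := lt_of_le_of_ne (not_lt.1 fun h => hlt.not_gt (h2.1 h)) hne2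
    have h4 := adj_of_not_isBack (h1.2 h3) hne hback
    exact ⟨iff_of_true h4 hlt, iff_of_false (adj_asymm h4) hlt.not_gt⟩
  · have h3 : q < β p := h2.2 hlt
    have h5 : β' q < β p := lt_of_le_of_ne (not_lt.1 fun h => h3.not_gt (h1.1 h)) hne3.symm
    have h4 := adj_of_not_isBack' h5 hne hback
    exact ⟨iff_of_false (adj_asymm h4) hlt.not_gt, iff_of_true h4 hlt⟩

/-- A flotilla embeds in a critical tournament with a sufficiently smooth chain. -/
theorem IsCritical.contains_of_smooth [Nonempty W] {X : Finset W} {t m l : ℝ} (h : T.IsCritical X t m)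
    (hl : 0 < l) (hln : 2 * (n + 4) * l ≤ 1) {S : ℕ → Finset W}
    (hS : ∀ p < n, S p ⊆ X ∧ 4 * m ≤ #(S p))
    (hsm : ∀ p < n, ∀ q < n, p ≠ q → Disjoint (S p) (S q) ∧
      ∀ v ∈ S p, (#{w ∈ S q | T.IsBack p q v w} : ℝ) ≤ l * #(S q))
    (hH : H.IsFlotillaOrdering θ) : T.Contains H := by
  have hm := h.pos
  have hdis : ∀ p < n, ∀ q < n, p ≠ q → Disjoint (S p) (S q) := fun p hp q hq hpq =>
    (hsm p hp q hq hpq).1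
  have hcount : ∀ p < n, ∀ q < n, ∀ v ∈ S p, (#{w ∈ S q | T.IsBack p q v w} : ℝ) ≤ l * #(S q) := by
    intro p hp q hq v hv
    by_cases hpq : p = q
    · subst hpq
      simp only [IsBack, lt_irrefl, false_and, or_self, Finset.filter_false, Finset.card_empty,
        Nat.cast_zero]
      positivity
    · exact (hsm p hp q hq hpq).2 v hv
  have key : ∀ 𝒞 : Finset (H.backwardGraph θ).ConnectedComponent,
      ∃ (φ : Fin n → W) (β : Fin n → Fin n),
        (∀ p, H.component θ p ∈ 𝒞 → H.IsPlaced θ S φ β p) ∧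
        ∀ p q, H.component θ p ∈ 𝒞 → H.component θ q ∈ 𝒞 →
          (T.Adj (φ p) (φ q) ↔ H.Adj (θ p) (θ q)) := by
    intro 𝒞
    induction 𝒞 using Finset.induction_on with
    | empty => exact ⟨fun _ => Classical.arbitrary W, id, by simp, by simp⟩
    | insert C 𝒞 hC𝒞 ih =>
      obtain ⟨φ, β, hpl, hadj⟩ := ih
      let P : Finset (Fin n) := {p | H.component θ p ∈ 𝒞}
      -- At most `n` vertices are already placed and each excludes a fraction `l`. By `hln`, at
      -- least half of each set survives, and more than the `3 * l` fraction that three further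
      -- vertices can exclude when `w` is chosen.
      let S' : ℕ → Finset W := fun q => {w ∈ S q | ∀ p ∈ P, ¬ T.IsBack (β p) q (φ p) w}
      have hS'S : ∀ q, S' q ⊆ S q := fun q => Finset.filter_subset _ _
      have hS'c : ∀ q < n, (1 - n * l) * #(S q) ≤ #(S' q) := by
        intro q hq
        have hsub : S q \ S' q ⊆ P.biUnion fun p => {w ∈ S q | T.IsBack (β p) q (φ p) w} := by
          intro w hw
          simp only [S', Finset.mem_sdiff, Finset.mem_filter, not_and, not_forall, not_not] at hw
          obtain ⟨hwS, hw⟩ := hw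
          obtain ⟨p, hp, hb⟩ := hw hwS
          exact Finset.mem_biUnion.2 ⟨p, hp, Finset.mem_filter.2 ⟨hwS, hb⟩⟩
        have h1 : (#(S q \ S' q) : ℝ) ≤ ∑ p ∈ P, (#{w ∈ S q | T.IsBack (β p) q (φ p) w} : ℝ) := by
          exact_mod_cast (Finset.card_le_card hsub).trans Finset.card_biUnion_le
        have h2 : ∑ p ∈ P, (#{w ∈ S q | T.IsBack (β p) q (φ p) w} : ℝ) ≤ ∑ _p ∈ P, l * #(S q) :=
          Finset.sum_le_sum fun p hp =>
            hcount _ (β p).2 q hq _ (hpl p (Finset.mem_filter.1 hp).2).1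
        rw [Finset.sum_const, nsmul_eq_mul] at h2
        have h3 : (#P : ℝ) * (l * #(S q)) ≤ n * (l * #(S q)) := by
          refine mul_le_mul_of_nonneg_right ?_ (by positivity)
          exact_mod_cast (Finset.card_le_univ P).trans_eq (Fintype.card_fin n)
        have h4 : (#(S q) : ℝ) ≤ #(S q \ S' q) + #(S' q) := by
          exact_mod_cast Nat.sub_le_iff_le_add.1 (Finset.le_card_sdiff (S' q) (S q))
        linarith
      obtain ⟨φ', β', hpl', hadj'⟩ := h.exists_placed_component (H := H) (θ := θ) (S := S') (C := C)
        (fun p hp => ⟨(hS'S p).trans (hS p hp).1, by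
          have h1 := hS'c p hp
          have h2 := (hS p hp).2
          nlinarith⟩)
        (fun p hp q hq hpq => Finset.disjoint_of_subset_left (hS'S p)
          (Finset.disjoint_of_subset_right (hS'S q) (hdis p hp q hq hpq)))
        (by
          intro r hr p hp q hq s hs _ _ _ x hx z hz y hy
          by_contra! hcon
          have hsub : S' r ⊆ {w ∈ S r | T.IsBack p r x w} ∪
              ({w ∈ S r | T.IsBack q r z w} ∪ {w ∈ S r | T.IsBack s r y w}) := by
            intro w hw
            have hwS := hS'S r hw
            have h1 := hcon w hw
            simp only [Finset.mem_union, Finset.mem_filter, hwS, true_and]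
            tauto
          have h1 : (#(S' r) : ℝ) ≤ #{w ∈ S r | T.IsBack p r x w} +
              (#{w ∈ S r | T.IsBack q r z w} + #{w ∈ S r | T.IsBack s r y w}) := by
            exact_mod_cast (Finset.card_le_card hsub).trans ((Finset.card_union_le _ _).trans
              (Nat.add_le_add_left (Finset.card_union_le _ _) _))
          have h2 := hcount p hp r hr x (hS'S _ hx)
          have h3 := hcount q hq r hr z (hS'S _ hz)
          have h4 := hcount s hs r hr y (hS'S _ hy)
          have h5 := hS'c r hr
          have h6 := (hS r hr).2
          nlinarith)
        (hH C)
      have hcross : ∀ p q, H.component θ p ∈ 𝒞 → H.component θ q = C →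
          (T.Adj (φ p) (φ' q) ↔ H.Adj (θ p) (θ q)) ∧ (T.Adj (φ' q) (φ p) ↔ H.Adj (θ q) (θ p)) := by
        intro p q hp hq
        have hpq : H.component θ p ≠ H.component θ q := fun e => hC𝒞 (hq ▸ e ▸ hp)
        rw [adj_iff_lt_of_component_ne hpq, adj_iff_lt_of_component_ne hpq.symm]
        refine adj_iff_lt_of_placed hdis hS'S (hpl p hp) (hpl' q hq) hpq ?_
        exact (Finset.mem_filter.1 (hpl' q hq).1).2 p (Finset.mem_filter.2 ⟨Finset.mem_univ _, hp⟩)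
      refine ⟨fun p => if H.component θ p = C then φ' p else φ p,
        fun p => if H.component θ p = C then β' p else β p, ?_, ?_⟩
      · intro p hp
        by_cases hpC : H.component θ p = C
        · have h1 := hpl' p hpC
          simp only [IsPlaced, if_pos hpC] at h1 ⊢
          exact ⟨hS'S _ h1.1, h1.2⟩
        · have h1 := hpl p ((Finset.mem_insert.1 hp).resolve_left hpC)
          simp only [IsPlaced, if_neg hpC] at h1 ⊢
          exact h1
      · intro p q hp hq
        by_cases hpC : H.component θ p = C <;> by_cases hqC : H.component θ q = C
        · simpa only [if_pos hpC, if_pos hqC] using hadj' p q hpC hqC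
        · simpa only [if_pos hpC, if_neg hqC] using
            (hcross q p ((Finset.mem_insert.1 hq).resolve_left hqC) hpC).2
        · simpa only [if_neg hpC, if_pos hqC] using
            (hcross p q ((Finset.mem_insert.1 hp).resolve_left hpC) hqC).1
        · simpa only [if_neg hpC, if_neg hqC] using hadj p q
            ((Finset.mem_insert.1 hp).resolve_left hpC) ((Finset.mem_insert.1 hq).resolve_left hqC)
  obtain ⟨φ, -, -, hadj⟩ := key (Finset.univ.image (H.component θ))
  refine contains_of_adj_iff (fun a => φ (θ.symm a)) fun a b => ?_
  simpa using hadj (θ.symm a) (θ.symm b) (by simp) (by simp)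

/-! ### The exponent and the minimal counterexample. -/

theorem IsFlotillaOrdering.satisfiesEHC (hH : H.IsFlotillaOrdering θ) :
    SatisfiesEHC.{u, v} H := by
  have hl : (0 : ℝ) < 1 / (2 * (n + 4)) := by positivity
  obtain ⟨c, hc, N, hN⟩ := exists_smooth_chain.{u, v} H θ n hl
  -- The bound `4 * d ≤ c` makes the chain sets at least `4 * m` large; `N * d ≤ 1` excludes
  -- counterexamples with fewer than `N` vertices. The `+ 2` keeps `d < 1` even for `N = 0`.
  obtain ⟨d, hd, hd1, hdc, hdN⟩ : ∃ d : ℝ, 0 < d ∧ d < 1 ∧ 4 * d ≤ c ∧ N * d ≤ 1 := by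
    refine ⟨min (c / 4) (1 / (N + 2)), by positivity, ?_, ?_, ?_⟩
    · refine (min_le_right _ _).trans_lt ?_
      rw [div_lt_one (by positivity)]
      linarith [(Nat.cast_nonneg N : (0 : ℝ) ≤ N)]
    · linarith [min_le_left (c / 4) (1 / ((N : ℝ) + 2))]
    · refine (mul_le_mul_of_nonneg_left (min_le_right _ _) (Nat.cast_nonneg N)).trans ?_
      rw [mul_one_div, div_le_one (by positivity)]
      linarith
  have hlogd : Real.log d < 0 := Real.log_neg hd hd1
  have hlog9 : Real.log (9 / 10) < 0 := Real.log_neg (by norm_num) (by norm_num)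
  set ε := Real.log (9 / 10) / Real.log d with hε
  have hεpos : 0 < ε := div_pos_of_neg_of_neg hlog9 hlogd
  have hdε : d ^ ε = 9 / 10 := by
    rw [Real.rpow_def_of_pos hd, hε, mul_div_cancel₀ _ hlogd.ne, Real.exp_log (by norm_num)]
  refine ⟨ε, hεpos, fun W _ T hT => ?_⟩
  have main : ∀ X : Finset W, ∃ Y ⊆ X, T.IsTransOn Y ∧ (#X : ℝ) ^ ε ≤ #Y := by
    intro X
    induction X using Finset.strongInduction with
    | H X ih =>
      by_contra! hcon
      have htwo : ∀ a ∈ X, ∀ b ∈ X, T.IsTransOn {a, b} := by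
        intro a _ b _ x hx y hy z hz hxy hyz
        simp only [Finset.mem_insert, Finset.mem_singleton] at hx hy hz
        rcases hx with rfl | rfl <;> rcases hy with rfl | rfl <;> rcases hz with rfl | rfl <;>
          first
          | assumption
          | exact absurd hxy (adj_asymm hyz)
      have hX2 : 1 < #X := by
        by_contra! hX
        rcases Nat.le_one_iff_eq_zero_or_eq_one.1 hX with h0 | h1
        · have := hcon ∅ (by simp) (by simp [IsTransOn])
          simp [h0, Real.zero_rpow hεpos.ne'] at this
        · obtain ⟨a, rfl⟩ := Finset.card_eq_one.1 h1
          have := hcon {a} le_rfl (by simpa using htwo a (by simp) a (by simp))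
          simp at this
      obtain ⟨a, ha, b, hb, hab⟩ := Finset.one_lt_card.1 hX2
      have ht : (2 : ℝ) < (#X : ℝ) ^ ε := by
        have := hcon {a, b} (by simp [Finset.insert_subset_iff, ha, hb]) (htwo a ha b hb)
        rw [Finset.card_pair hab] at this
        exact_mod_cast this
      have hXpos : (0 : ℝ) < #X := by
        exact_mod_cast (by omega : 0 < #X)
      -- Otherwise `9/10 * |X| ^ ε = (d|X|) ^ ε ≤ 1`, contradicting `|X| ^ ε > 2`.
      have hXN : N ≤ #X := by
        by_contra! hlt
        have h1 : d * #X ≤ 1 := by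
          have : (#X : ℝ) ≤ N := by exact_mod_cast hlt.le
          nlinarith
        have h2 : (d * #X) ^ ε ≤ 1 := Real.rpow_le_one (by positivity) h1 hεpos.le
        rw [Real.mul_rpow hd.le hXpos.le, hdε] at h2
        linarith
      have hcrit : T.IsCritical X ((#X : ℝ) ^ ε) (d * #X) :=
        { two_lt := ht
          pos := by positivity
          card_lt := hcon
          exists_trans := by
            intro Z hZ hm
            obtain ⟨Y, hY, hYT, hYc⟩ := ih Z hZ
            refine ⟨Y, hY, hYT, le_trans ?_ hYc⟩
            rw [← hdε, ← Real.mul_rpow hd.le hXpos.le]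
            exact Real.rpow_le_rpow (by positivity) hm hεpos.le }
      obtain ⟨S, hS, hsm⟩ := hN T hT X hXN
      have : Nonempty W := ⟨a⟩
      refine hT (hcrit.contains_of_smooth hl (le_of_eq (by field_simp)) (fun p hp =>
        ⟨(hS p hp).1, le_trans ?_ (hS p hp).2⟩) hsm hH)
      rw [← mul_assoc]
      exact mul_le_mul_of_nonneg_right hdc hXpos.le
  obtain ⟨Y, -, hYT, hYc⟩ := main Finset.univ
  exact ⟨Y, hYT.isTransitive_induce, by simpa using hYc⟩

end FlotillaEHC.Tournament

theorem mainTheorem2 {V : Type u} [Fintype V] (H : FlotillaEHC.Tournament V)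
    (hH : H.IsFlotilla) : FlotillaEHC.Tournament.SatisfiesEHC.{u, v} H := by
  obtain ⟨θ, hθ⟩ := hH
  exact hθ.satisfiesEHC
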